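/- Let $q$ be a prime power, and let $\mathcal H_q$ be the Hermitian curve over $\mathbb F_{q^2}$, i.e. the nonsingular projective plane curve with affine equation $x^{q+1}=y^q+y$. It has a unique point at infinity $P_\infty$, and its field of rational functions is $\mathbb F_{q^2}(\mathcal H_q)=\mathbb F_{q^2}(x,y)$. Let $m$ be an integer with $q-1\le m\le q^2-1$, let $\alpha_1,\dots,\alpha_m\in\mathbb F_{q^2}\setminus\{0\}$ be pairwise distinct, and let $P_{i,z}=(\alpha_i,\beta_{i,z})$, for $1\le i\le m$ and $1\le z\le q$, be $mq$ pairwise distinct affine $\mathbb F_{q^2}$-rational points of $\mathcal H_q$. Put $$h=\prod_{i=1}^m\frac1{x-\alpha_i},\qquad D^{info}=\sum_{i=1}^m\sum_{z=1}^q P_{i,z}-P_\infty,$$ and, for $1\le z\le q$ and $1\le i\le m-z+1$, $$\bar h_i^{(z)}=y^{z-1}\prod_{\substack{1\le i'\le m-z+1\\ i'\ne i}}(x-\alpha_{i'}).$$ Then the functions $h\cdot\bar h_i^{(z)}$, for $1\le z\le q$ and $1\le i\le m-z+1$, form an $\mathbb F_{q^2}$-basis of the Riemann–Roch space $$\mathcal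 L(D^{info})=\{f\in\mathbb F_{q^2}(\mathcal H_q)\setminus\{0\}:(f)+D^{info}\ge 0\}\cup\{0\},$$ where $(f)$ is the principal divisor of $f$. -/

import Mathlib

open Polynomial
open scoped Polynomial.Bivariate WithZero

noncomputable section

namespace Hermitian

/-! ### The Hermitian curve `X ^ (q + 1) = Y ^ q + Y` and its function field -/

/-- The defining polynomial `Y ^ q + Y - X ^ (q + 1)`, as a polynomial in `Y` over `F[X]`. -/
def poly (F : Type*) [Field F] (q : ℕ) : F[X][Y] := Y ^ q + Y - C (X ^ (q + 1))

/-- The coordinate ring `F[X, Y] / (Y ^ q + Y - X ^ (q + 1))` of the affine Hermitian curve. -/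
abbrev CoordRing (F : Type*) [Field F] (q : ℕ) : Type _ := AdjoinRoot (poly F q)

/-- The field `F(H_q)` of rational functions on the Hermitian curve. -/
abbrev FunField (F : Type*) [Field F] (q : ℕ) : Type _ := FractionRing (CoordRing F q)

theorem one_lt_q (F : Type*) [Field F] [Fintype F] (q : ℕ)
    [hF : Fact (Fintype.card F = q ^ 2)] : 1 < q := by
  have h1 := Fintype.one_lt_card (α := F)
  rw [hF.out] at h1
  by_contra h
  have : q = 0 ∨ q = 1 := by omega
  rcases this with rfl | rfl <;> simp at h1

theorem natCast_q (F : Type*) [Field F] [Fintype F] (q : ℕ)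
    [hF : Fact (Fintype.card F = q ^ 2)] : (q : F) = 0 := by
  have h : ((Fintype.card F : ℕ) : F) = 0 := Nat.cast_card_eq_zero F
  rw [hF.out, Nat.cast_pow] at h
  exact pow_eq_zero_iff (two_ne_zero) |>.mp h

theorem natDegree_poly (F : Type*) [Field F] (q : ℕ) (hq : 1 < q) :
    (poly F q).natDegree = q := by
  unfold poly
  compute_degree!
  · simp [show ¬ 1 = q by omega, show ¬ q = 0 by omega]
  · omega

theorem monic_poly (F : Type*) [Field F] (q : ℕ) (hq : 1 < q) : (poly F q).Monic := by
  unfold poly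
  rw [add_sub_assoc]
  refine monic_X_pow_add ?_
  refine (degree_sub_le _ _).trans_lt ?_
  rw [degree_X, max_lt_iff]
  exact ⟨by exact_mod_cast hq, degree_C_le.trans_lt (by exact_mod_cast (by omega))⟩

theorem irreducible_poly (F : Type*) [Field F] (q : ℕ) (hq : 1 < q) :
    Irreducible (poly F q) := by
  -- exchange the variables and use Eisenstein's criterion at the prime `X` of `F[X]`
  have hs : Irreducible (X ^ (q + 1) - C (X ^ q + X) : F[X][Y]) := by
    have hm : (X ^ (q + 1) - C (X ^ q + X) : F[X][Y]).Monic :=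
      monic_X_pow_sub_C _ (by omega)
    have hdeg : (X ^ (q + 1) - C (X ^ q + X) : F[X][Y]).degree = (q + 1 : ℕ) :=
      degree_X_pow_sub_C (by omega) _
    have hP : (Ideal.span {(X : F[X])}).IsPrime :=
      (Ideal.span_singleton_prime X_ne_zero).mpr prime_X
    refine irreducible_of_eisenstein_criterion hP ?_ ?_ ?_ ?_ hm.isPrimitive
    · rw [hm.leadingCoeff]
      exact (Ideal.ne_top_iff_one _).mp hP.ne_top
    · intro n hn
      rw [hdeg] at hn
      have hn' : n < q + 1 := by exact_mod_cast hn
      rw [coeff_sub, coeff_X_pow, if_neg (by omega), zero_sub, coeff_C]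
      split_ifs
      · rw [neg_mem_iff, Ideal.mem_span_singleton]
        exact dvd_add (dvd_pow_self _ (by omega)) dvd_rfl
      · simp
    · rw [hdeg]
      exact_mod_cast Nat.succ_pos q
    · rw [coeff_sub, coeff_X_pow, if_neg (by omega), zero_sub, coeff_C_zero, neg_mem_iff,
        Ideal.span_singleton_pow, Ideal.mem_span_singleton, X_pow_dvd_iff]
      intro h
      have := h 1 (by omega)
      simp [coeff_X_pow, show ¬ 1 = q by omega] at this
  have he : Bivariate.swap (poly F q) = -(X ^ (q + 1) - C (X ^ q + X) : F[X][Y]) := by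
    simp only [poly, map_sub, map_add, map_pow, Bivariate.swap_X, Bivariate.swap_Y]
    ring
  rw [← MulEquiv.irreducible_iff (Bivariate.swap (R := F)), he]
  exact (Associated.refl _).neg_left.irreducible_iff.mpr hs

instance isDomain_coordRing (F : Type*) [Field F] [Fintype F] (q : ℕ)
    [Fact (Fintype.card F = q ^ 2)] : IsDomain (CoordRing F q) :=
  AdjoinRoot.isDomain_of_prime (irreducible_poly F q (one_lt_q F q)).prime

section Functions

variable (F : Type*) [Field F] (q : ℕ)

/-- The coordinate function `x`, in the coordinate ring. -/
def rx : CoordRing F q := AdjoinRoot.of (poly F q) X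

/-- The coordinate function `y`, in the coordinate ring. -/
def ry : CoordRing F q := AdjoinRoot.root (poly F q)

/-- The coordinate function `x`. -/
def fx : FunField F q := algebraMap (CoordRing F q) (FunField F q) (rx F q)

/-- The coordinate function `y`. -/
def fy : FunField F q := algebraMap (CoordRing F q) (FunField F q) (ry F q)

theorem ry_eq : ry F q ^ q + ry F q = rx F q ^ (q + 1) := by
  have h : AdjoinRoot.mk (poly F q) (Y ^ q + Y - C (X ^ (q + 1))) = 0 := AdjoinRoot.mk_self
  simp only [map_sub, map_add, map_pow, AdjoinRoot.mk_X, AdjoinRoot.mk_C] at h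
  exact sub_eq_zero.mp h

theorem fy_eq : fy F q ^ q + fy F q = fx F q ^ (q + 1) := by
  simp only [fx, fy, ← map_pow, ← map_add, ry_eq]

end Functions

theorem isDedekindDomain_of_derivative_eq_one {A R k K : Type*} [CommRing A] [IsDedekindDomain A]
    [CommRing R] [IsDomain R] [Algebra A R] [Module.Finite A R] [Field k] [Field K]
    [Algebra A k] [IsFractionRing A k] [Algebra R K] [IsFractionRing R K] [Algebra A K]
    [Algebra k K] [IsScalarTower A R K] [IsScalarTower A k K] [FaithfulSMul A R]
    (y : R) (htop : Algebra.adjoin A {y} = ⊤) (f : A[X]) (hm : f.Monic) (hirr : Irreducible f)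
    (hder : derivative f = 1) (hf : aeval y f = 0) : IsDedekindDomain R := by
  have : FiniteDimensional k K := .of_isLocalization A R (nonZeroDivisors A)
  have hR : ∀ r : R, algebraMap R K r ∈ Algebra.adjoin k {algebraMap R K y} := by
    intro r
    have hr : r ∈ Algebra.adjoin A {y} := htop ▸ Algebra.mem_top
    induction hr using Algebra.adjoin_induction with
    | mem x hx =>
      rw [Set.mem_singleton_iff.mp hx]
      exact Algebra.subset_adjoin (Set.mem_singleton _)
    | algebraMap a =>
      rw [← IsScalarTower.algebraMap_apply, IsScalarTower.algebraMap_apply A k K]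
      exact Subalgebra.algebraMap_mem _ _
    | add x z _ _ hx hz => rw [map_add]; exact add_mem hx hz
    | mul x z _ _ hx hz => rw [map_mul]; exact mul_mem hx hz
  have htop' : Algebra.adjoin k {algebraMap R K y} = ⊤ := by
    refine eq_top_iff.mpr fun z _ => ?_
    obtain ⟨a, b, -, rfl⟩ := IsFractionRing.div_surjective (A := R) z
    rw [div_eq_mul_inv]
    exact mul_mem (hR a) (Subalgebra.inv_mem_of_algebraic _ (x := ⟨_, hR b⟩)
      (Algebra.IsAlgebraic.isAlgebraic (R := k) (algebraMap R K b)))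
  have hy : aeval (algebraMap R K y) f = 0 := by
    rw [aeval_algebraMap_apply, hf, map_zero]
  have hsep : Algebra.IsSeparable k K := by
    have h1 : f.Separable := by
      rw [separable_def, hder]
      exact isCoprime_one_right
    have h2 : IsSeparable k (algebraMap R K y) :=
      (h1.map (f := algebraMap A k)).of_dvd (minpoly.dvd _ _ (by rwa [aeval_map_algebraMap]))
    have h3 := (IntermediateField.isSeparable_adjoin_simple_iff_isSeparable _ _).mpr h2
    have h4 : IntermediateField.adjoin k {algebraMap R K y} = ⊤ := by
      rw [← IntermediateField.toSubalgebra_inj, IntermediateField.top_toSubalgebra, eq_top_iff,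
        ← htop']
      exact IntermediateField.algebra_adjoin_le_adjoin _ _
    rw [h4] at h3
    exact Algebra.IsSeparable.of_algHom _ _ (IntermediateField.topEquiv.symm.toAlgHom)
  have : IsDedekindDomain (integralClosure A K) := integralClosure.isDedekindDomain A k K
  have : Module.IsTorsionFree A (integralClosure A K) := by
    have : FaithfulSMul A K := (faithfulSMul_iff_algebraMap_injective A K).mpr (by
      rw [IsScalarTower.algebraMap_eq A k K]
      exact (algebraMap k K).injective.comp (IsFractionRing.injective A k))
    infer_instance
  let y₀ : integralClosure A K := ⟨algebraMap R K y, f, hm, hy⟩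
  have hy₀ : aeval y₀ f = 0 := by
    apply Subtype.val_injective
    exact (aeval_algebraMap_apply K y₀ f).symm.trans hy
  have hint : IsIntegral A y₀ := ⟨f, hm, hy₀⟩
  have hminp : minpoly A y₀ = f := by
    refine eq_of_monic_of_associated (minpoly.monic hint) hm ?_
    exact ((minpoly.irreducible hint).dvd_irreducible_iff_associated hirr).mp
      (minpoly.isIntegrallyClosed_dvd hint hy₀)
  have hcond := conductor_mul_differentIdeal A k K y₀ htop'
  rw [hminp, hder, map_one, Ideal.span_singleton_one] at hcond
  have hadj := adjoin_eq_top_of_conductor_eq_top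
    (eq_top_iff.mpr (hcond.symm.le.trans Ideal.mul_le_left))
  have : IsIntegralClosure R A K :=
    { algebraMap_injective := IsFractionRing.injective R K
      isIntegral_iff := by
        intro z
        constructor
        · intro hz
          have h : (⟨z, hz⟩ : integralClosure A K) ∈ Algebra.adjoin A {y₀} := hadj ▸ Algebra.mem_top
          rw [Algebra.adjoin_singleton_eq_range_aeval] at h
          obtain ⟨g, hg⟩ := h
          refine ⟨aeval y g, ?_⟩
          rw [← aeval_algebraMap_apply]
          exact (aeval_algebraMap_apply K y₀ g).trans (congrArg Subtype.val hg)
        · rintro ⟨r, rfl⟩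
          exact (Algebra.IsIntegral.isIntegral (R := A) r).algebraMap }
  exact IsIntegralClosure.isDedekindDomain A k K R

theorem of_injective (F : Type*) [Field F] (q : ℕ) (hq : 1 < q) :
    Function.Injective (algebraMap F[X] (CoordRing F q)) :=
  AdjoinRoot.of.injective_of_degree_ne_zero (by
    rw [degree_eq_natDegree (monic_poly F q hq).ne_zero, natDegree_poly F q hq]
    exact_mod_cast (by omega))

/-- The affine Hermitian curve is nonsingular: its coordinate ring is a Dedekind domain. -/
instance isDedekindDomain_coordRing (F : Type*) [Field F] [Fintype F] (q : ℕ)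
    [Fact (Fintype.card F = q ^ 2)] : IsDedekindDomain (CoordRing F q) := by
  have hq := one_lt_q F q
  have hm := monic_poly F q hq
  have hder : derivative (poly F q) = 1 := by
    have : (q : F[X]) = 0 := by
      rw [← map_natCast (C : F →+* F[X]) q, natCast_q F q, map_zero]
    simp [poly, derivative_pow, this]
  have : Module.Finite F[X] (CoordRing F q) := hm.finite_adjoinRoot
  have : FaithfulSMul F[X] (CoordRing F q) :=
    (faithfulSMul_iff_algebraMap_injective _ _).mpr (of_injective F q hq)
  have : FaithfulSMul F[X] (FunField F q) := by
    rw [faithfulSMul_iff_algebraMap_injective, IsScalarTower.algebraMap_eq _ (CoordRing F q)]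
    exact (IsFractionRing.injective (CoordRing F q) (FunField F q)).comp (of_injective F q hq)
  let _ : Algebra (FractionRing F[X]) (FunField F q) :=
    FractionRing.liftAlgebra F[X] (FunField F q)
  exact isDedekindDomain_of_derivative_eq_one (k := FractionRing F[X]) (K := FunField F q)
    (AdjoinRoot.root (poly F q)) (AdjoinRoot.adjoinRoot_eq_top) (poly F q) hm
    (irreducible_poly F q hq) hder (AdjoinRoot.eval₂_root _)

/-! ### Places, divisors and Riemann-Roch spaces of a function field `K / F` -/

/-- A place of `K / F`, given by its normalized discrete valuation: a surjective valuation with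
value group `ℤ` that is trivial on the constants. (The valuation is written multiplicatively.) -/
structure Place (F K : Type*) [Field F] [Field K] [Algebra F K] where
  val : Valuation K ℤᵐ⁰
  surjective : Function.Surjective val
  trivial_on : ∀ a : F, a ≠ 0 → val (algebraMap F K a) = 1

/-- The order `v_P(f)` of a nonzero function `f` at the place `P`
(positive at zeros of `f`, negative at poles). -/
def Place.ord {F K : Type*} [Field F] [Field K] [Algebra F K] (P : Place F K) (f : K) : ℤ :=
  -WithZero.log (P.val f)

/-- Divisors: finite formal sums of places. -/
abbrev Divisor (F K : Type*) [Field F] [Field K] [Algebra F K] : Type _ := Place F K →₀ ℤ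

/-- The Riemann-Roch space `L(D) = {f | (f) + D ≥ 0} ∪ {0}`. -/
def RRSpace {F K : Type*} [Field F] [Field K] [Algebra F K] (D : Divisor F K) :
    Submodule F K where
  carrier := {f | f = 0 ∨ ∀ P : Place F K, 0 ≤ P.ord f + D P}
  zero_mem' := Or.inl rfl
  add_mem' := by
    intro f g hf hg
    by_cases hf0 : f = 0
    · simpa [hf0] using hg
    by_cases hg0 : g = 0
    · simpa [hg0] using hf
    by_cases hfg : f + g = 0
    · exact Or.inl hfg
    refine Or.inr fun P => ?_
    have h1 := hf.resolve_left hf0 P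
    have h2 := hg.resolve_left hg0 P
    have hne : ∀ {u : K}, u ≠ 0 → P.val u ≠ 0 := fun hu => (Valuation.ne_zero_iff _).mpr hu
    simp only [Place.ord] at *
    rcases le_max_iff.mp (P.val.map_add f g) with h | h
    · have := (WithZero.log_le_log (hne hfg) (hne hf0)).mpr h
      omega
    · have := (WithZero.log_le_log (hne hfg) (hne hg0)).mpr h
      omega
  smul_mem' := by
    intro c f hf
    by_cases hc : c = 0
    · exact Or.inl (by simp [hc])
    rcases hf with rfl | hf
    · exact Or.inl (smul_zero c)
    · refine Or.inr fun P => ?_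
      have h := hf P
      simp only [Place.ord] at *
      rwa [Algebra.smul_def, map_mul, P.trivial_on c hc, one_mul]

/-! ### The rational points of the Hermitian curve, as places -/

theorem aeval_fx (F : Type*) [Field F] (q : ℕ) (g : F[X]) : aeval (fx F q) g = algebraMap F[X] (FunField F q) g := by
  have h : fx F q = algebraMap F[X] (FunField F q) X := by
    rw [IsScalarTower.algebraMap_apply F[X] (CoordRing F q)]
    rfl
  rw [h, aeval_algebraMap_apply, aeval_X_left_apply]

theorem evalEval_poly {F : Type*} [Field F] {q : ℕ} {a b : F} (h : b ^ q + b = a ^ (q + 1)) :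
    (poly F q).evalEval a b = 0 := by
  simp [poly, evalEval_C, evalEval_pow, evalEval_X, h]

section Points

variable (F : Type*) [Field F] [Fintype F] (q : ℕ) [Fact (Fintype.card F = q ^ 2)]

theorem algebraMap_fun_injective : Function.Injective (algebraMap F[X] (FunField F q)) := by
  rw [IsScalarTower.algebraMap_eq _ (CoordRing F q)]
  exact (IsFractionRing.injective (CoordRing F q) (FunField F q)).comp
    (of_injective F q (one_lt_q F q))

theorem transcendental_fx : Transcendental F (fx F q) := by
  rw [transcendental_iff_injective]
  intro g₁ g₂ h
  rw [aeval_fx, aeval_fx] at h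
  exact algebraMap_fun_injective F q h

theorem fx_ne_zero : fx F q ≠ 0 := fun h =>
  transcendental_fx F q (h ▸ isAlgebraic_zero)

theorem fy_ne_zero : fy F q ≠ 0 := by
  intro h
  have := fy_eq F q
  have hq := one_lt_q F q
  rw [h, zero_pow (by omega), add_zero] at this
  exact fx_ne_zero F q (pow_eq_zero_iff (by omega) |>.mp this.symm)

variable {F q}

/-- The maximal ideal of the coordinate ring of all functions vanishing at the point `(a, b)`. -/
def pointIdeal (a b : F) (h : b ^ q + b = a ^ (q + 1)) :
    IsDedekindDomain.HeightOneSpectrum (CoordRing F q) where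
  asIdeal := RingHom.ker (AdjoinRoot.evalEval (evalEval_poly h))
  isPrime := RingHom.ker_isPrime _
  ne_bot := by
    intro hbot
    have h0 : rx F q - AdjoinRoot.of (poly F q) (C a) = 0 := by
      rw [← Ideal.mem_bot, ← hbot, RingHom.mem_ker]
      simp [rx, AdjoinRoot.evalEval]
    have h1 : AdjoinRoot.of (poly F q) (X - C a) = AdjoinRoot.of (poly F q) 0 := by
      rw [map_sub, map_zero]
      exact h0
    exact X_sub_C_ne_zero a (of_injective F q (one_lt_q F q) h1)

/-- The place at the affine rational point `(a, b)`: the valuation of the local ring at `(a, b)`. -/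
def affinePlace (a b : F) (h : b ^ q + b = a ^ (q + 1)) : Place F (FunField F q) where
  val := (pointIdeal a b h).valuation (FunField F q)
  surjective := (pointIdeal a b h).valuation_surjective (FunField F q)
  trivial_on := by
    intro c hc
    rw [IsScalarTower.algebraMap_apply F (CoordRing F q) (FunField F q),
      IsDedekindDomain.HeightOneSpectrum.valuation_eq_one_iff_notMem]
    intro hmem
    exact (pointIdeal a b h).isPrime.ne_top
      (Ideal.eq_top_of_isUnit_mem _ hmem ((isUnit_iff_ne_zero.mpr hc).map (algebraMap F _)))

variable (F q)

/-- The homomorphism `x ↦ x / y`, `y ↦ 1 / y` of the coordinate ring into the function field. -/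
def chartHom : CoordRing F q →+* FunField F q :=
  AdjoinRoot.lift (aeval (fx F q / fy F q) : F[X] →ₐ[F] FunField F q).toRingHom (fy F q)⁻¹ (by
    have hy := fy_ne_zero F q
    have h := fy_eq F q
    simp only [poly, eval₂_sub, eval₂_add, eval₂_pow, eval₂_X, eval₂_C, map_pow,
      AlgHom.toRingHom_eq_coe, RingHom.coe_coe, aeval_X]
    rw [div_pow, ← h, inv_pow, pow_succ]
    field_simp
    simp [add_comm])

theorem chartHom_rx : chartHom F q (rx F q) = fx F q / fy F q := by
  simp [chartHom, rx]

theorem chartHom_ry : chartHom F q (ry F q) = (fy F q)⁻¹ := by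
  simp [chartHom, ry]

theorem chartHom_algebraMap (c : F) :
    chartHom F q (algebraMap F (CoordRing F q) c) = algebraMap F (FunField F q) c := by
  have h : algebraMap F (CoordRing F q) c = AdjoinRoot.of (poly F q) (C c) := rfl
  rw [h]
  simp [chartHom]

theorem chartHom_injective : Function.Injective (chartHom F q) := by
  have hq := one_lt_q F q
  have hy := fy_ne_zero F q
  have : Module.Finite F[X] (CoordRing F q) := (monic_poly F q hq).finite_adjoinRoot
  have htr : Transcendental F (fx F q / fy F q) := by
    intro halg
    have hinv : IsAlgebraic F (fy F q)⁻¹ := by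
      have h1 : ((fy F q)⁻¹) ^ q + (fy F q)⁻¹ = (fx F q / fy F q) ^ (q + 1) := by
        rw [← chartHom_rx, ← chartHom_ry, ← map_pow, ← map_pow, ← map_add, ry_eq]
      have hmon : (X ^ q + X : F[X]).Monic :=
        monic_X_pow_add (by rw [degree_X]; exact_mod_cast hq)
      have hdeg : (X ^ q + X : F[X]).natDegree ≠ 0 := by
        rw [natDegree_add_eq_left_of_natDegree_lt (by simpa using hq), natDegree_X_pow]
        omega
      refine (IsIntegral.of_aeval_monic hmon hdeg ?_).isAlgebraic
      rw [map_add, map_pow, aeval_X, h1]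
      exact halg.isIntegral.pow _
    have := halg.mul (hinv.inv)
    rw [inv_inv, div_mul_cancel₀ _ hy] at this
    exact transcendental_fx F q this
  rw [RingHom.injective_iff_ker_eq_bot]
  refine Ideal.eq_bot_of_comap_eq_bot (R := F[X]) (eq_bot_iff.mpr fun g hg => ?_)
  have hg' : aeval (fx F q / fy F q) g = 0 := by
    have : chartHom F q (AdjoinRoot.of (poly F q) g) = 0 := hg
    simpa [chartHom] using this
  exact (transcendental_iff.mp htr) g hg'

/-- The automorphism `x ↦ x / y`, `y ↦ 1 / y` of the function field. It is induced by the
projectivity `(X : Y : Z) ↦ (X : Z : Y)` of the curve `X ^ (q + 1) = Y ^ q Z + Y Z ^ q`, which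
exchanges the origin `(0 : 0 : 1)` with the point at infinity `(0 : 1 : 0)`. -/
def chartAut : FunField F q →+* FunField F q :=
  IsFractionRing.lift (chartHom_injective F q)

theorem chartAut_fx : chartAut F q (fx F q) = fx F q / fy F q := by
  rw [fx, chartAut, IsFractionRing.lift_algebraMap, chartHom_rx]
  rfl

theorem chartAut_fy : chartAut F q (fy F q) = (fy F q)⁻¹ := by
  rw [fy, chartAut, IsFractionRing.lift_algebraMap, chartHom_ry]
  rfl

theorem chartAut_algebraMap (c : F) :
    chartAut F q (algebraMap F (FunField F q) c) = algebraMap F (FunField F q) c := by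
  rw [IsScalarTower.algebraMap_apply F (CoordRing F q) (FunField F q), chartAut,
    IsFractionRing.lift_algebraMap, chartHom_algebraMap, ← IsScalarTower.algebraMap_apply]

theorem chartAut_chartAut (f : FunField F q) : chartAut F q (chartAut F q f) = f := by
  have hy := fy_ne_zero F q
  suffices h : (chartAut F q).comp (chartAut F q) = RingHom.id _ from RingHom.congr_fun h f
  refine IsLocalization.ringHom_ext (nonZeroDivisors (CoordRing F q)) ?_
  refine Ideal.Quotient.ringHom_ext (Polynomial.ringHom_ext' (Polynomial.ringHom_ext ?_ ?_) ?_)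
  · intro c
    have h := chartAut_algebraMap F q c
    change chartAut F q (chartAut F q (algebraMap F (FunField F q) c)) =
      algebraMap F (FunField F q) c
    rw [h, h]
  · change chartAut F q (chartAut F q (fx F q)) = fx F q
    rw [chartAut_fx, map_div₀, chartAut_fx, chartAut_fy]
    field_simp
  · change chartAut F q (chartAut F q (fy F q)) = fy F q
    rw [chartAut_fy, map_inv₀, chartAut_fy, inv_inv]

/-- The place at the point at infinity `(0 : 1 : 0)`: the pull-back of the place at the origin
under the automorphism `x ↦ x / y`, `y ↦ 1 / y`. -/
def inftyPlace : Place F (FunField F q) where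
  val := (affinePlace (0 : F) 0 (by
    have := one_lt_q F q
    rw [zero_pow (by omega), zero_pow (by omega), add_zero])).val.comap (chartAut F q)
  surjective := by
    intro γ
    obtain ⟨f, hf⟩ := (affinePlace (q := q) (0 : F) 0 _).surjective γ
    exact ⟨chartAut F q f, by rw [Valuation.comap_apply, chartAut_chartAut, hf]⟩
  trivial_on := by
    intro c hc
    rw [Valuation.comap_apply, chartAut_algebraMap]
    exact Place.trivial_on _ c hc

end Points

/-! ### The functions `h`, `h̄` and the divisor -/

section Construction

variable {F : Type*} [Field F] [Fintype F] {q : ℕ} [Fact (Fintype.card F = q ^ 2)] {m : ℕ}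

/-- The index set of the functions `h̄`. Indices start at `0` here: the pair `(i, z)` stands for
the function with lower index `i + 1 ∈ [m - (z + 1) + 1]` and upper index `z + 1 ∈ [q]`. -/
abbrev Index (q m : ℕ) : Type := {p : Fin m × Fin q // (p.1 : ℕ) + (p.2 : ℕ) < m}

/-- `h = ∏ i, (x - α i)⁻¹`. -/
def hFun (α : Fin m → F) : FunField F q :=
  ∏ i, (fx F q - algebraMap F (FunField F q) (α i))⁻¹

/-- `h̄ = y ^ z * ∏ i' ≠ i, (x - α i')`, the product over the indices `i'` with `i' + z < m`. -/
def hBar (α : Fin m → F) (p : Index q m) : FunField F q :=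
  fy F q ^ (p.1.2 : ℕ) *
    ∏ i' ∈ Finset.univ.filter (fun i' : Fin m => (i' : ℕ) + (p.1.2 : ℕ) < m ∧ i' ≠ p.1.1),
      (fx F q - algebraMap F (FunField F q) (α i'))

/-- `D^info = ∑ i, ∑ z, P i z - P_∞`, where `P i z` is the point `(α i, β i z)`. -/
def infoDivisor (α : Fin m → F) (β : Fin m → Fin q → F)
    (hP : ∀ i z, β i z ^ q + β i z = α i ^ (q + 1)) : Divisor F (FunField F q) :=
  ∑ i, ∑ z, Finsupp.single (affinePlace (α i) (β i z) (hP i z)) 1 -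
    Finsupp.single (inftyPlace F q) 1

end Construction

end Hermitian

end

/-! Write `f = h * g`. Away from infinity the divisor of `∏ i, (x - α i)` is exactly the sum of the
points `P i z`, and at infinity this product has a pole of order `q * m`. Hence `h * g` lies in
`L(D^info)` iff `g` is regular at every affine place and its pole order at infinity is less than `q
* m` (`mem_RRSpace_infoDivisor_iff_forall`). The coordinate ring is Dedekind, so regularity at the
affine places means that `g` lies in it, i.e. `g = ∑ z, g_z(x) y ^ z` with `z < q`.

At infinity `x` and `y` have poles of order `q` and `q + 1`. The orders `q * deg g_z + (q + 1) * z`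
of the nonzero terms are distinct modulo `q`, so nothing cancels and the bound holds termwise: `deg
g_z < m - z` (`mem_RRSpace_infoDivisor_iff`). For each `z` the functions `h̄` are, up to the factor
`y ^ z`, nonzero multiples of the Lagrange basis at the first `m - z` nodes, so they form a basis of
that space of polynomials (`exists_rowPoly_eq`, `eval_rowPoly`).

Places are arbitrary normalized valuations, so they have to be classified where they matter: a place
centred at a rational affine point is the place of that point (`Place.IsOver.eq_affinePlace`), and a
place where `x` has a pole is the place at infinity (`Place.eq_inftyPlace`). -/

noncomputable section

namespace Hermitian

/-! ### Orders and valuations at a place -/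

section OrderCalculus

variable {F K : Type*} [Field F] [Field K] [Algebra F K]

theorem Place.ext_val {P Q : Place F K} (h : ∀ f, P.val f = Q.val f) : P = Q := by
  have h' : P.val = Q.val := Valuation.ext h
  cases P
  cases Q
  cases h'
  rfl

theorem Place.val_algebraMap_le_one (P : Place F K) (c : F) : P.val (algebraMap F K c) ≤ 1 := by
  by_cases hc : c = 0
  · simp [hc]
  · exact (P.trivial_on c hc).le

theorem Place.isTrivialOn (P : Place F K) : P.val.IsTrivialOn F where
  eq_one := P.trivial_on

theorem Place.val_ne_zero (P : Place F K) {f : K} (hf : f ≠ 0) : P.val f ≠ 0 :=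
  (Valuation.ne_zero_iff _).mpr hf

theorem Place.ord_mul (P : Place F K) {f g : K} (hf : f ≠ 0) (hg : g ≠ 0) :
    P.ord (f * g) = P.ord f + P.ord g := by
  simp only [ord, map_mul, WithZero.log_mul (P.val_ne_zero hf) (P.val_ne_zero hg)]
  ring

theorem Place.ord_inv (P : Place F K) (f : K) : P.ord f⁻¹ = -P.ord f := by
  simp [ord, WithZero.log_inv]

theorem Place.ord_pow (P : Place F K) (f : K) (n : ℕ) : P.ord (f ^ n) = n * P.ord f := by
  simp [ord, WithZero.log_pow]

theorem Place.ord_prod (P : Place F K) {ι : Type*} (s : Finset ι) (f : ι → K)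
    (hf : ∀ i ∈ s, f i ≠ 0) : P.ord (∏ i ∈ s, f i) = ∑ i ∈ s, P.ord (f i) := by
  classical
  induction s using Finset.induction_on with
  | empty => simp [ord]
  | insert i s hi ih =>
    rw [Finset.prod_insert hi, Finset.sum_insert hi,
      P.ord_mul (hf i (by simp)) (Finset.prod_ne_zero_iff.mpr fun j hj => hf j (by simp [hj])),
      ih fun j hj => hf j (by simp [hj])]

theorem Place.val_eq_exp (P : Place F K) {f : K} (hf : f ≠ 0) :
    P.val f = WithZero.exp (-P.ord f) := by
  rw [ord, neg_neg, WithZero.exp_log (P.val_ne_zero hf)]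

theorem Place.val_le_one_iff (P : Place F K) {f : K} (hf : f ≠ 0) :
    P.val f ≤ 1 ↔ 0 ≤ P.ord f := by
  rw [P.val_eq_exp hf, ← WithZero.exp_zero, WithZero.exp_le_exp, neg_nonpos]

theorem Place.val_lt_one_iff (P : Place F K) {f : K} (hf : f ≠ 0) :
    P.val f < 1 ↔ 0 < P.ord f := by
  rw [P.val_eq_exp hf, ← WithZero.exp_zero, WithZero.exp_lt_exp, neg_lt_zero]

theorem Place.val_aeval_le_one (P : Place F K) {x : K} (hx : P.val x ≤ 1) (g : F[X]) :
    P.val (aeval x g) ≤ 1 := by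
  rw [aeval_eq_sum_range]
  refine P.val.map_sum_le fun i _ => ?_
  rw [Algebra.smul_def, map_mul, map_pow]
  exact mul_le_one' (P.val_algebraMap_le_one _) (pow_le_one' hx i)

theorem Place.val_sub_algebraMap_le_one (P : Place F K) {x : K} (hx : P.val x ≤ 1) (c : F) :
    P.val (x - algebraMap F K c) ≤ 1 :=
  (P.val.map_sub _ _).trans (max_le hx (P.val_algebraMap_le_one c))

theorem Place.val_le_one_of_sub_algebraMap (P : Place F K) {x : K} {c : F}
    (hx : P.val (x - algebraMap F K c) < 1) : P.val x ≤ 1 := by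
  rw [← sub_add_cancel x (algebraMap F K c)]
  exact (P.val.map_add _ _).trans (max_le hx.le (P.val_algebraMap_le_one c))

theorem Place.val_sub_algebraMap_of_one_lt (P : Place F K) {x : K} (hx : 1 < P.val x) (c : F) :
    P.val (x - algebraMap F K c) = P.val x := by
  rw [sub_eq_add_neg]
  refine P.val.map_add_eq_of_lt_left ?_
  rw [Valuation.map_neg]
  exact (P.val_algebraMap_le_one c).trans_lt hx

theorem Place.eq_of_val_sub_algebraMap_lt_one (P : Place F K) {x : K} {c d : F}
    (hc : P.val (x - algebraMap F K c) < 1) (hd : P.val (x - algebraMap F K d) < 1) : c = d := by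
  by_contra h
  have h1 : P.val (algebraMap F K (c - d)) < 1 := by
    have : algebraMap F K (c - d) = (x - algebraMap F K d) - (x - algebraMap F K c) := by
      rw [map_sub]; ring
    rw [this]
    exact (P.val.map_sub _ _).trans_lt (max_lt hd hc)
  exact h1.ne (P.trivial_on _ (sub_ne_zero.mpr h))

end OrderCalculus

/-! ### Normal form in the coordinate ring: polynomials in `x` times `1, y, ..., y ^ (q - 1)` -/

section CoordinateRing

variable (F : Type*) [Field F] (q : ℕ)

theorem coordRing_eq_sum (hq : 1 < q) (r : CoordRing F q) :
    ∃ g : Fin q → F[X], r = ∑ z, algebraMap F[X] (CoordRing F q) (g z) * ry F q ^ (z : ℕ) := by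
  obtain ⟨p, rfl⟩ := AdjoinRoot.mk_surjective r
  have hmon := monic_poly F q hq
  refine ⟨fun z => (p %ₘ poly F q).coeff z, ?_⟩
  have hdeg : (p %ₘ poly F q).natDegree < q := by
    have := natDegree_modByMonic_lt p hmon (by
      intro h
      have := natDegree_poly F q hq
      rw [h, natDegree_one] at this
      omega)
    rwa [natDegree_poly F q hq] at this
  have h1 : AdjoinRoot.mk (poly F q) p = AdjoinRoot.mk (poly F q) (p %ₘ poly F q) := by
    conv_lhs => rw [← modByMonic_add_div p (poly F q)]
    simp
  rw [h1]
  conv_lhs => rw [as_sum_range_C_mul_X_pow' _ hdeg]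
  rw [map_sum, Finset.sum_range]
  refine Finset.sum_congr rfl fun z _ => ?_
  rw [map_mul, map_pow, AdjoinRoot.mk_X, AdjoinRoot.mk_C]
  rfl

theorem algebraMap_coordRing_eq_sum [Fintype F] [Fact (Fintype.card F = q ^ 2)]
    (r : CoordRing F q) :
    ∃ g : Fin q → F[X], algebraMap (CoordRing F q) (FunField F q) r =
      ∑ z, aeval (fx F q) (g z) * fy F q ^ (z : ℕ) := by
  obtain ⟨g, rfl⟩ := coordRing_eq_sum F q (one_lt_q F q) r
  refine ⟨g, ?_⟩
  rw [map_sum]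
  refine Finset.sum_congr rfl fun z _ => ?_
  rw [map_mul, map_pow, aeval_fx, IsScalarTower.algebraMap_apply F[X] (CoordRing F q) (FunField F q)]
  rfl

end CoordinateRing

/-! ### Evaluation at a rational point -/

section EvaluationAtPoint

variable {F : Type*} [Field F] {q : ℕ}

/-- First-order expansion at the point: divide by `Y - b`, then divide the remainder, a polynomial
in `X`, by `X - a`. So `x - a` and `y - b` generate the ideal of the point. -/
theorem exists_eq_evalEval_add (a b : F) (h : b ^ q + b = a ^ (q + 1)) (r : CoordRing F q) :
    ∃ A B : CoordRing F q, r = algebraMap F _ (AdjoinRoot.evalEval (evalEval_poly h) r) +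
      A * (rx F q - algebraMap F _ a) + B * (ry F q - algebraMap F _ b) := by
  obtain ⟨p, rfl⟩ := AdjoinRoot.mk_surjective r
  obtain ⟨u, hu⟩ := X_sub_C_dvd_sub_C_eval (p := p) (a := C b)
  obtain ⟨w, hw⟩ := X_sub_C_dvd_sub_C_eval (p := p.eval (C b)) (a := a)
  refine ⟨AdjoinRoot.of _ w, AdjoinRoot.mk _ u, ?_⟩
  have e1 := congrArg (AdjoinRoot.mk (poly F q)) hu
  have e2 := congrArg (AdjoinRoot.of (poly F q)) hw
  simp only [map_sub, map_mul, AdjoinRoot.mk_C, AdjoinRoot.mk_X] at e1 e2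
  have e3 : AdjoinRoot.evalEval (evalEval_poly h) (AdjoinRoot.mk (poly F q) p) =
      (p.eval (C b)).eval a := AdjoinRoot.evalEval_mk _ _
  rw [e3]
  change _ = AdjoinRoot.of (poly F q) (C ((p.eval (C b)).eval a)) +
    _ * (AdjoinRoot.of (poly F q) X - AdjoinRoot.of (poly F q) (C a)) +
    _ * (AdjoinRoot.root (poly F q) - AdjoinRoot.of (poly F q) (C b))
  linear_combination e1 + e2

theorem evalEval_rx (a b : F) (h : b ^ q + b = a ^ (q + 1)) :
    AdjoinRoot.evalEval (evalEval_poly h) (rx F q) = a := by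
  simp [rx, AdjoinRoot.evalEval]

theorem evalEval_ry (a b : F) (h : b ^ q + b = a ^ (q + 1)) :
    AdjoinRoot.evalEval (evalEval_poly h) (ry F q) = b := by
  simp [ry, AdjoinRoot.evalEval]

theorem evalEval_algebraMap (a b : F) (h : b ^ q + b = a ^ (q + 1)) (c : F) :
    AdjoinRoot.evalEval (evalEval_poly h) (algebraMap F (CoordRing F q) c) = c := by
  have : algebraMap F (CoordRing F q) c = AdjoinRoot.of (poly F q) (C c) := rfl
  rw [this]
  simp [AdjoinRoot.evalEval]

theorem algebraMap_rx_sub (a : F) : algebraMap (CoordRing F q) (FunField F q)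
    (rx F q - algebraMap F _ a) = fx F q - algebraMap F _ a := by
  rw [map_sub, ← IsScalarTower.algebraMap_apply]
  rfl

theorem algebraMap_ry_sub (b : F) : algebraMap (CoordRing F q) (FunField F q)
    (ry F q - algebraMap F _ b) = fy F q - algebraMap F _ b := by
  rw [map_sub, ← IsScalarTower.algebraMap_apply]
  rfl

end EvaluationAtPoint

/-! ### Places centred at an affine rational point -/

section LocalTheory

variable {F : Type*} [Field F] [Fintype F] {q : ℕ} [Fact (Fintype.card F = q ^ 2)]

theorem fx_sub_algebraMap_ne_zero (c : F) : fx F q - algebraMap F (FunField F q) c ≠ 0 := by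
  intro h
  refine transcendental_fx F q ?_
  rw [sub_eq_zero.mp h]
  exact isAlgebraic_algebraMap c

/-- If `y` had a pole, `y ^ q` would dominate `y`, and `y ^ q + y = x ^ (q + 1)` would have a pole
as well. -/
theorem Place.val_fy_le_one (P : Place F (FunField F q)) (hx : P.val (fx F q) ≤ 1) :
    P.val (fy F q) ≤ 1 := by
  by_contra! hy
  have hq := one_lt_q F q
  have h1 : P.val (fy F q ^ q + fy F q) = P.val (fy F q) ^ q := by
    rw [P.val.map_add_eq_of_lt_left, map_pow]
    rw [map_pow]
    simpa using pow_lt_pow_right₀ hy hq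
  rw [fy_eq, map_pow] at h1
  have h2 : 1 < P.val (fy F q) ^ q := one_lt_pow' hy (by omega)
  rw [← h1] at h2
  exact h2.not_ge (pow_le_one' hx _)

theorem Place.val_coordRing_le_one (P : Place F (FunField F q)) (hx : P.val (fx F q) ≤ 1)
    (r : CoordRing F q) : P.val (algebraMap _ _ r) ≤ 1 := by
  obtain ⟨g, hg⟩ := algebraMap_coordRing_eq_sum F q r
  rw [hg]
  refine P.val.map_sum_le fun z _ => ?_
  rw [map_mul, map_pow]
  exact mul_le_one' (P.val_aeval_le_one hx _) (pow_le_one' (P.val_fy_le_one hx) _)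

/-- The place `P` is centred at the affine point `(a, b)`. -/
def Place.IsOver (P : Place F (FunField F q)) (a b : F) : Prop :=
  P.val (fx F q - algebraMap F _ a) < 1 ∧ P.val (fy F q - algebraMap F _ b) < 1

theorem mem_pointIdeal_iff (a b : F) (h : b ^ q + b = a ^ (q + 1)) (r : CoordRing F q) :
    r ∈ (pointIdeal a b h).asIdeal ↔ AdjoinRoot.evalEval (evalEval_poly h) r = 0 :=
  RingHom.mem_ker

theorem affinePlace_isOver (a b : F) (h : b ^ q + b = a ^ (q + 1)) :
    (affinePlace a b h).IsOver a b := by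
  constructor
  · rw [← algebraMap_rx_sub]
    refine ((pointIdeal a b h).valuation_lt_one_iff_mem _).mpr ?_
    rw [mem_pointIdeal_iff, map_sub, evalEval_rx a b h, evalEval_algebraMap a b h, sub_self]
  · rw [← algebraMap_ry_sub]
    refine ((pointIdeal a b h).valuation_lt_one_iff_mem _).mpr ?_
    rw [mem_pointIdeal_iff, map_sub, evalEval_ry a b h, evalEval_algebraMap a b h, sub_self]

theorem Place.IsOver.val_lt_one {P : Place F (FunField F q)} {a b : F} (hP : P.IsOver a b)
    (h : b ^ q + b = a ^ (q + 1)) {r : CoordRing F q} (hr : r ∈ (pointIdeal a b h).asIdeal) :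
    P.val (algebraMap _ _ r) < 1 := by
  rw [mem_pointIdeal_iff] at hr
  obtain ⟨A, B, hAB⟩ := exists_eq_evalEval_add a b h r
  have hx := P.val_le_one_of_sub_algebraMap hP.1
  rw [hr, map_zero, zero_add] at hAB
  rw [hAB, map_add, map_mul, map_mul, algebraMap_rx_sub, algebraMap_ry_sub]
  refine (P.val.map_add _ _).trans_lt (max_lt ?_ ?_)
  · rw [map_mul]
    exact (mul_le_of_le_one_left' (P.val_coordRing_le_one hx A)).trans_lt hP.1
  · rw [map_mul]
    exact (mul_le_of_le_one_left' (P.val_coordRing_le_one hx B)).trans_lt hP.2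

/-- Such an `r` differs from the nonzero constant `r(a, b)` by an element of the ideal, whose
valuation is less than `1`. -/
theorem Place.IsOver.val_eq_one {P : Place F (FunField F q)} {a b : F} (hP : P.IsOver a b)
    (h : b ^ q + b = a ^ (q + 1)) {r : CoordRing F q} (hr : r ∉ (pointIdeal a b h).asIdeal) :
    P.val (algebraMap _ _ r) = 1 := by
  have h1 : r - algebraMap F _ (AdjoinRoot.evalEval (evalEval_poly h) r) ∈
      (pointIdeal a b h).asIdeal := by
    rw [mem_pointIdeal_iff, map_sub, evalEval_algebraMap a b h, sub_self]
  have h2 := hP.val_lt_one h h1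
  rw [map_sub, ← IsScalarTower.algebraMap_apply] at h2
  have h3 := P.trivial_on _ (fun h0 => hr ((mem_pointIdeal_iff a b h r).mpr h0))
  rw [← sub_add_cancel (algebraMap _ (FunField F q) r)
    (algebraMap F (FunField F q) (AdjoinRoot.evalEval (evalEval_poly h) r)),
    P.val.map_add_eq_of_lt_right (by rwa [h3]), h3]

/-- Smoothness at the point: `x - a` generates the maximal ideal of the local ring. Subtracting the
curve equations at `(x, y)` and `(a, b)` gives `(S + 1) * (y - b) = (x - a) * T`, where `S` and `T`
are the geometric sums of `y ^ q - b ^ q` and `x ^ (q + 1) - a ^ (q + 1)`. -/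
theorem exists_mul_eq_of_mem_pointIdeal {a b : F} (h : b ^ q + b = a ^ (q + 1))
    {r : CoordRing F q} (hr : r ∈ (pointIdeal a b h).asIdeal) :
    ∃ s ∉ (pointIdeal a b h).asIdeal, ∃ r', s * r = (rx F q - algebraMap F _ a) * r' := by
  have hq := one_lt_q F q
  rw [mem_pointIdeal_iff] at hr
  obtain ⟨A, B, hAB⟩ := exists_eq_evalEval_add a b h r
  rw [hr, map_zero, zero_add] at hAB
  set a' := algebraMap F (CoordRing F q) a with ha'
  set b' := algebraMap F (CoordRing F q) b with hb'
  have e1 := (Commute.all (ry F q) b').geom_sum₂_mul q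
  have e2 := (Commute.all (rx F q) a').geom_sum₂_mul (q + 1)
  set S := ∑ i ∈ Finset.range q, ry F q ^ i * b' ^ (q - 1 - i) with hS
  set T := ∑ i ∈ Finset.range (q + 1), rx F q ^ i * a' ^ (q + 1 - 1 - i)
  have e3 := ry_eq F q
  have e4 : b' ^ q + b' = a' ^ (q + 1) := by
    rw [ha', hb', ← map_pow, ← map_pow, ← map_add, h]
  refine ⟨S + 1, ?_, (S + 1) * A + B * T, ?_⟩
  -- At the point `S` takes the value `q * b ^ (q - 1) = 0`, because the characteristic divides `q`;
  -- hence `S + 1` takes the value `1`.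
  · rw [mem_pointIdeal_iff, map_add, map_one, hS, map_sum]
    simp only [map_mul, map_pow, evalEval_ry a b h, hb', evalEval_algebraMap a b h]
    rw [Finset.sum_congr rfl (g := fun _ => b ^ (q - 1))]
    · simp [natCast_q F q]
    · intro i hi
      rw [Finset.mem_range] at hi
      rw [← pow_add]
      congr 1
      omega
  · rw [hAB]
    linear_combination B * e1 + B * e3 - B * e4 - B * e2

/-- The exponent `k` is chosen before `P`; this uniformity is what later identifies all places over
the point. The order at `affinePlace` serves only as the induction measure: each division by `x - a`
lowers it. -/
theorem exists_val_coordRing_eq_pow (a b : F) (h : b ^ q + b = a ^ (q + 1)) (n : ℕ) :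
    ∀ r : CoordRing F q, r ≠ 0 → (affinePlace a b h).ord (algebraMap _ _ r) ≤ n →
      ∃ k : ℕ, ∀ P : Place F (FunField F q), P.IsOver a b →
        P.val (algebraMap _ _ r) = P.val (fx F q - algebraMap F _ a) ^ k := by
  have hinj := IsFractionRing.injective (CoordRing F q) (FunField F q)
  induction n with
  | zero =>
    intro r hr hn
    refine ⟨0, fun P hP => ?_⟩
    rw [pow_zero]
    refine hP.val_eq_one h fun hmem => ?_
    have h1 := (affinePlace_isOver a b h).val_lt_one h hmem
    rw [Place.val_lt_one_iff _ ((map_ne_zero_iff _ hinj).mpr hr)] at h1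
    push_cast at hn
    omega
  | succ n ih =>
    intro r hr hn
    by_cases hmem : r ∈ (pointIdeal a b h).asIdeal
    · obtain ⟨s, hs, r', hr'⟩ := exists_mul_eq_of_mem_pointIdeal h hmem
      have hs0 : s ≠ 0 := fun h0 => hs (h0 ▸ zero_mem _)
      have hr0 : r' ≠ 0 := by
        rintro rfl
        rw [mul_zero] at hr'
        exact (mul_ne_zero hs0 hr) hr'
      have key : ∀ P : Place F (FunField F q), P.IsOver a b → P.val (algebraMap _ _ r) =
          P.val (fx F q - algebraMap F _ a) * P.val (algebraMap _ _ r') := by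
        intro P hP
        rw [← map_mul, ← algebraMap_rx_sub, ← map_mul, ← hr', map_mul, map_mul,
          hP.val_eq_one h hs, one_mul]
      have hr0' := (map_ne_zero_iff _ hinj).mpr hr0
      have hover := affinePlace_isOver a b h
      obtain ⟨k, hk⟩ := ih r' hr0 (by
        have h1 := key _ hover
        rw [← map_mul] at h1
        have h2 : (affinePlace a b h).ord (algebraMap _ _ r) = (affinePlace a b h).ord
            ((fx F q - algebraMap F _ a) * algebraMap _ _ r') := by
          rw [Place.ord, h1, Place.ord]
        rw [Place.ord_mul _ (fx_sub_algebraMap_ne_zero a) hr0'] at h2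
        have h3 := (Place.val_lt_one_iff _ (fx_sub_algebraMap_ne_zero a)).mp hover.1
        push_cast at hn
        omega)
      exact ⟨k + 1, fun P hP => by rw [key P hP, hk P hP, pow_succ']⟩
    · exact ⟨0, fun P hP => by rw [pow_zero, hP.val_eq_one h hmem]⟩

theorem exists_val_eq_zpow (a b : F) (h : b ^ q + b = a ^ (q + 1)) {f : FunField F q}
    (hf : f ≠ 0) : ∃ k : ℤ, ∀ P : Place F (FunField F q), P.IsOver a b →
      P.val f = P.val (fx F q - algebraMap F _ a) ^ k := by
  obtain ⟨r, s, hs, rfl⟩ := IsFractionRing.div_surjective (A := CoordRing F q) f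
  have hs0 : s ≠ 0 := nonZeroDivisors.ne_zero hs
  have hr0 : r ≠ 0 := by
    rintro rfl
    simp at hf
  obtain ⟨k, hk⟩ := exists_val_coordRing_eq_pow a b h _ r hr0 (Int.self_le_toNat _)
  obtain ⟨l, hl⟩ := exists_val_coordRing_eq_pow a b h _ s hs0 (Int.self_le_toNat _)
  refine ⟨k - l, fun P hP => ?_⟩
  rw [map_div₀, hk P hP, hl P hP,
    zpow_sub₀ (P.val_ne_zero (fx_sub_algebraMap_ne_zero a)), zpow_natCast, zpow_natCast]

/-- Since the valuation is onto, some function has order `1`; it has the valuation of a power of `x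
- a`, so the positive integer `ord (x - a)` divides `1`. -/
theorem Place.IsOver.ord_fx_sub {P : Place F (FunField F q)} {a b : F} (hP : P.IsOver a b)
    (h : b ^ q + b = a ^ (q + 1)) : P.ord (fx F q - algebraMap F _ a) = 1 := by
  obtain ⟨f, hf⟩ := P.surjective (WithZero.exp (-1))
  have hf0 : f ≠ 0 := by
    rintro rfl
    rw [map_zero] at hf
    exact WithZero.exp_ne_zero hf.symm
  obtain ⟨k, hk⟩ := exists_val_eq_zpow a b h hf0
  have h1 := hk P hP
  have h2 := (P.val_lt_one_iff (fx_sub_algebraMap_ne_zero a)).mp hP.1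
  rw [hf] at h1
  have h3 := congrArg WithZero.log h1
  rw [WithZero.log_exp, WithZero.log_zpow, smul_eq_mul] at h3
  have h4 : k * P.ord (fx F q - algebraMap F _ a) = 1 := by
    rw [Place.ord]
    linarith
  exact Int.eq_one_of_mul_eq_one_left h2.le h4

theorem Place.IsOver.eq_affinePlace {P : Place F (FunField F q)} {a b : F} (hP : P.IsOver a b)
    (h : b ^ q + b = a ^ (q + 1)) : P = affinePlace a b h := by
  refine Place.ext_val fun f => ?_
  by_cases hf : f = 0
  · simp [hf]
  obtain ⟨k, hk⟩ := exists_val_eq_zpow a b h hf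
  have hQ := affinePlace_isOver a b h
  have ht := fx_sub_algebraMap_ne_zero (q := q) a
  rw [hk _ hP, hk _ hQ, P.val_eq_exp ht, Place.val_eq_exp _ ht, hP.ord_fx_sub h, hQ.ord_fx_sub h]

end LocalTheory

/-! ### The place at infinity and pole orders there -/

section Infinity

variable {F : Type*} [Field F] [Fintype F] {q : ℕ} [Fact (Fintype.card F = q ^ 2)]

theorem zero_pow_add_zero (F : Type*) [Field F] [Fintype F] (q : ℕ)
    [Fact (Fintype.card F = q ^ 2)] : (0 : F) ^ q + 0 = 0 ^ (q + 1) := by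
  have := one_lt_q F q
  rw [zero_pow (by omega), zero_pow (by omega), add_zero]

theorem ord_fx_origin : (affinePlace (0 : F) 0 (zero_pow_add_zero F q)).ord (fx F q) = 1 := by
  simpa using (affinePlace_isOver _ _ (zero_pow_add_zero F q)).ord_fx_sub (zero_pow_add_zero F q)

/-- At the origin `y ^ q` is negligible against `y`, so `y` has the order of `x ^ (q + 1)`. -/
theorem ord_fy_origin :
    (affinePlace (0 : F) 0 (zero_pow_add_zero F q)).ord (fy F q) = q + 1 := by
  have hq := one_lt_q F q
  set P := affinePlace (0 : F) 0 (zero_pow_add_zero F q) with hPdef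
  have hy : P.val (fy F q) < 1 := by
    simpa using (affinePlace_isOver _ _ (zero_pow_add_zero F q)).2
  have h0 : P.val (fy F q ^ q + fy F q) = P.val (fy F q) := by
    refine P.val.map_add_eq_of_lt_right ?_
    rw [map_pow]
    simpa using pow_lt_pow_right_of_lt_one₀
      (zero_lt_iff.mpr (P.val_ne_zero (fy_ne_zero F q))) hy hq
  have h1 : P.ord (fy F q) = P.ord (fx F q ^ (q + 1)) := by
    rw [← fy_eq, Place.ord, Place.ord, h0]
  rw [h1, P.ord_pow, ord_fx_origin]
  push_cast
  ring

theorem ord_inftyPlace (f : FunField F q) : (inftyPlace F q).ord f =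
    (affinePlace (0 : F) 0 (zero_pow_add_zero F q)).ord (chartAut F q f) := rfl

theorem ord_fx_inftyPlace : (inftyPlace F q).ord (fx F q) = -q := by
  rw [ord_inftyPlace, chartAut_fx, div_eq_mul_inv,
    Place.ord_mul _ (fx_ne_zero F q) (inv_ne_zero (fy_ne_zero F q)), Place.ord_inv,
    ord_fx_origin, ord_fy_origin]
  ring

theorem ord_fy_inftyPlace : (inftyPlace F q).ord (fy F q) = -(q + 1) := by
  rw [ord_inftyPlace, chartAut_fy, Place.ord_inv, ord_fy_origin]

theorem one_lt_val_fx_inftyPlace : 1 < (inftyPlace F q).val (fx F q) := by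
  have := one_lt_q F q
  rw [Place.val_eq_exp _ (fx_ne_zero F q), ord_fx_inftyPlace, ← WithZero.exp_zero,
    WithZero.exp_lt_exp]
  omega

/-- A pole of `x` forces one of `y`; then `y ^ q` dominates `y`, and `|y| ^ q = |x| ^ (q + 1) > |x|
^ q`. -/
theorem Place.val_fx_lt_val_fy (P : Place F (FunField F q)) (hx : 1 < P.val (fx F q)) :
    P.val (fx F q) < P.val (fy F q) := by
  have hq := one_lt_q F q
  have h1 := congrArg P.val (fy_eq F q)
  rw [map_pow] at h1
  have hx' : 1 < P.val (fx F q) ^ (q + 1) := one_lt_pow' hx (by omega)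
  have hy : 1 < P.val (fy F q) := by
    by_contra! hy
    have h2 : P.val (fy F q ^ q + fy F q) ≤ 1 := by
      refine (P.val.map_add _ _).trans (max_le ?_ hy)
      rw [map_pow]
      exact pow_le_one' hy q
    rw [h1] at h2
    exact h2.not_gt hx'
  have h3 : P.val (fy F q ^ q + fy F q) = P.val (fy F q) ^ q := by
    rw [P.val.map_add_eq_of_lt_left, map_pow]
    rw [map_pow]
    simpa using pow_lt_pow_right₀ hy hq
  rw [h3] at h1
  refine lt_of_pow_lt_pow_left₀ q zero_le ?_
  rw [h1]
  exact pow_lt_pow_right₀ hx (Nat.lt_succ_self q)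

/-- Pulled back along the involution `chartAut`, the place becomes centred at the origin, since `x /
y` and `1 / y` vanish at `P`; only one place is centred there. -/
theorem Place.eq_inftyPlace (P : Place F (FunField F q)) (hx : 1 < P.val (fx F q)) :
    P = inftyPlace F q := by
  have hxy := P.val_fx_lt_val_fy hx
  have hy := hx.trans hxy
  let Q : Place F (FunField F q) :=
    { val := P.val.comap (chartAut F q)
      surjective := by
        intro γ
        obtain ⟨f, hf⟩ := P.surjective γ
        exact ⟨chartAut F q f, by rw [Valuation.comap_apply, chartAut_chartAut, hf]⟩
      trivial_on := by
        intro c hc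
        rw [Valuation.comap_apply, chartAut_algebraMap]
        exact P.trivial_on c hc }
  have hQ : Q.IsOver 0 0 := by
    constructor
    · rw [map_zero, sub_zero]
      change P.val (chartAut F q (fx F q)) < 1
      rw [chartAut_fx, map_div₀]
      exact (div_lt_one₀ (zero_lt_one.trans hy)).mpr hxy
    · rw [map_zero, sub_zero]
      change P.val (chartAut F q (fy F q)) < 1
      rw [chartAut_fy, map_inv₀]
      exact inv_lt_one_of_one_lt₀ hy
  have hQ' := hQ.eq_affinePlace (zero_pow_add_zero F q)
  refine Place.ext_val fun f => ?_
  have h1 : P.val f = Q.val (chartAut F q f) := by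
    change P.val f = P.val (chartAut F q (chartAut F q f))
    rw [chartAut_chartAut]
  rw [h1, hQ']
  rfl

theorem val_inftyPlace_aeval_mul_pow {g : F[X]} (hg : g ≠ 0) (z : ℕ) :
    (inftyPlace F q).val (aeval (fx F q) g * fy F q ^ z) =
      WithZero.exp ((q * g.natDegree + (q + 1) * z : ℕ) : ℤ) := by
  have := (inftyPlace F q).isTrivialOn
  rw [map_mul, map_pow,
    valuation_aeval_eq_valuation_X_pow_natDegree_of_one_lt_valuation_X _
      one_lt_val_fx_inftyPlace hg, Place.val_eq_exp _ (fx_ne_zero F q),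
    Place.val_eq_exp _ (fy_ne_zero F q), ord_fx_inftyPlace, ord_fy_inftyPlace,
    ← WithZero.exp_nsmul, ← WithZero.exp_nsmul, ← WithZero.exp_add]
  congr 1
  push_cast
  simp only [nsmul_eq_mul]
  ring

/-- No cancellation at infinity: the nonzero terms have distinct valuations, so the sum has the
valuation of its largest term. -/
theorem val_inftyPlace_le_val_sum (g : Fin q → F[X]) (z : Fin q) :
    (inftyPlace F q).val (aeval (fx F q) (g z) * fy F q ^ (z : ℕ)) ≤
      (inftyPlace F q).val (∑ z, aeval (fx F q) (g z) * fy F q ^ (z : ℕ)) := by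
  by_cases hgz : g z = 0
  · simp [hgz]
  set v : Fin q → ℤᵐ⁰ :=
    fun z => (inftyPlace F q).val (aeval (fx F q) (g z) * fy F q ^ (z : ℕ)) with hv
  obtain ⟨w, -, hw⟩ := Finset.exists_max_image Finset.univ v ⟨z, Finset.mem_univ z⟩
  have hvz : v z ≠ 0 := by
    rw [hv]
    dsimp only
    rw [val_inftyPlace_aeval_mul_pow hgz]
    exact WithZero.exp_ne_zero
  have hvw : 0 < v w := (zero_lt_iff.mpr hvz).trans_le (hw z (Finset.mem_univ z))
  have hgw : g w ≠ 0 := by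
    intro h
    simp [hv, h] at hvw
  have hsum : (inftyPlace F q).val (∑ z, aeval (fx F q) (g z) * fy F q ^ (z : ℕ)) = v w := by
    refine Valuation.map_sum_eq_of_lt _ (Finset.mem_univ w) fun u hu => ?_
    have huw : u ≠ w := by simpa using hu
    refine lt_of_le_of_ne (hw u (Finset.mem_univ u)) fun heq => huw ?_
    by_cases hgu : g u = 0
    · rw [hgu, map_zero, zero_mul, map_zero] at heq
      exact absurd heq hvw.ne
    · rw [val_inftyPlace_aeval_mul_pow hgu, val_inftyPlace_aeval_mul_pow hgw,
        WithZero.exp_inj, Nat.cast_inj] at heq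
      have h1 := congrArg (· % q) heq
      -- Modulo `q` the pole order of a term is `z`, which determines `z` because `z < q`.
      have e : ∀ d z : ℕ, q * d + (q + 1) * z = z + q * (d + z) := fun d z => by ring
      simp only [e, Nat.add_mul_mod_self_left, Nat.mod_eq_of_lt u.2, Nat.mod_eq_of_lt w.2] at h1
      exact Fin.ext h1
  rw [hsum]
  exact hw z (Finset.mem_univ z)

theorem eq_zero_of_sum_eq_zero {g : Fin q → F[X]}
    (hg : ∑ z, aeval (fx F q) (g z) * fy F q ^ (z : ℕ) = 0) : g = 0 := by
  funext z
  by_contra hz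
  have h := val_inftyPlace_le_val_sum g z
  rw [hg, map_zero, val_inftyPlace_aeval_mul_pow hz, le_zero_iff] at h
  exact WithZero.exp_ne_zero h

end Infinity

/-! ### The divisor `D^info` and its Riemann-Roch space -/

section InfoDivisor

variable {F : Type*} [Field F] [Fintype F] {q : ℕ} [Fact (Fintype.card F = q ^ 2)] {m : ℕ}

/-- The `q` distinct values `b z` are all the roots of `Y ^ q + Y - a ^ (q + 1)`. Substituting `y`
gives `x ^ (q + 1) - a ^ (q + 1) = ∏ z, (y - b z)`; the left side vanishes at `P`, hence so does a
factor on the right. -/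
theorem exists_isOver {a : F} {b : Fin q → F} (hb : Function.Injective b)
    (h : ∀ z, b z ^ q + b z = a ^ (q + 1)) {P : Place F (FunField F q)}
    (hP : P.val (fx F q - algebraMap F _ a) < 1) : ∃ z, P.IsOver a (b z) := by
  have hq := one_lt_q F q
  have hpoly : (X ^ q + X - C (a ^ (q + 1)) : F[X]) = ∏ z, (X - C (b z)) := by
    have hlow : (X - C (a ^ (q + 1)) : F[X]).degree < q := by
      rw [degree_X_sub_C]
      exact_mod_cast hq
    have hmon : (X ^ q + X - C (a ^ (q + 1)) : F[X]).Monic := by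
      rw [add_sub_assoc]
      exact monic_X_pow_add hlow
    have hdeg : (X ^ q + X - C (a ^ (q + 1)) : F[X]).degree = q := by
      rw [add_sub_assoc, degree_add_eq_left_of_degree_lt (by rwa [degree_X_pow]), degree_X_pow]
    have hmon' : (∏ z, (X - C (b z)) : F[X]).Monic := monic_prod_of_monic _ _ fun z _ =>
      monic_X_sub_C _
    have hdeg' : (∏ z, (X - C (b z)) : F[X]).degree = q := by
      simp [degree_prod]
    -- Both polynomials are monic of degree `q`, so their difference has degree below `q` and
    -- vanishes at `q` points.
    refine eq_of_degree_sub_lt_of_eval_index_eq Finset.univ (v := b) hb.injOn ?_ fun z _ => ?_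
    · rw [Finset.card_univ, Fintype.card_fin, ← hdeg]
      exact degree_sub_lt_left (hdeg.trans hdeg'.symm) hmon.ne_zero
        (hmon.leadingCoeff.trans hmon'.leadingCoeff.symm)
    · rw [eval_prod, Finset.prod_eq_zero (Finset.mem_univ z) (by simp)]
      simp [h z]
  have h1 : fx F q ^ (q + 1) - algebraMap F _ a ^ (q + 1) =
      ∏ z, (fy F q - algebraMap F _ (b z)) := by
    have := congrArg (aeval (fy F q)) hpoly
    simpa [map_prod, fy_eq] using this
  have h2 : P.val (∏ z, (fy F q - algebraMap F _ (b z))) < 1 := by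
    rw [← h1, ← (Commute.all (fx F q) _).geom_sum₂_mul, map_mul]
    refine (mul_le_of_le_one_left' (P.val.map_sum_le fun i _ => ?_)).trans_lt hP
    rw [map_mul, map_pow, map_pow]
    exact mul_le_one' (pow_le_one' (P.val_le_one_of_sub_algebraMap hP) _)
      (pow_le_one' (P.val_algebraMap_le_one _) _)
  by_contra! hne
  rw [map_prod] at h2
  refine h2.ne (Finset.prod_eq_one fun z _ => ?_)
  have hy := P.val_fy_le_one (P.val_le_one_of_sub_algebraMap hP)
  exact le_antisymm (P.val_sub_algebraMap_le_one hy _) (not_lt.mp fun hz => hne z ⟨hP, hz⟩)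

variable (α : Fin m → F) (β : Fin m → Fin q → F)
  (hP : ∀ i z, β i z ^ q + β i z = α i ^ (q + 1))

theorem affinePlace_ne_inftyPlace (a b : F) (h : b ^ q + b = a ^ (q + 1)) :
    affinePlace a b h ≠ inftyPlace F q := by
  intro heq
  have h1 := Place.val_le_one_of_sub_algebraMap _ (affinePlace_isOver a b h).1
  rw [heq] at h1
  exact h1.not_gt one_lt_val_fx_inftyPlace

open Classical in
theorem infoDivisor_apply (P : Place F (FunField F q)) : infoDivisor α β hP P =
    (∑ i, ∑ z, if affinePlace (α i) (β i z) (hP i z) = P then 1 else 0) -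
      if inftyPlace F q = P then 1 else 0 := by
  simp [infoDivisor, Finsupp.single_apply]

theorem infoDivisor_inftyPlace : infoDivisor α β hP (inftyPlace F q) = -1 := by
  simp [infoDivisor_apply, affinePlace_ne_inftyPlace]

/-- The function `∏ i, (x - α i)`. -/
def nodalFun : FunField F q := ∏ i, (fx F q - algebraMap F (FunField F q) (α i))

theorem nodalFun_ne_zero : nodalFun (q := q) α ≠ 0 :=
  Finset.prod_ne_zero_iff.mpr fun i _ => fx_sub_algebraMap_ne_zero (α i)

theorem hFun_eq : hFun (q := q) α = (nodalFun α)⁻¹ := by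
  simp [hFun, nodalFun]

theorem ord_nodalFun (P : Place F (FunField F q)) : P.ord (nodalFun α) =
    ∑ i, P.ord (fx F q - algebraMap F (FunField F q) (α i)) :=
  P.ord_prod _ _ fun i _ => fx_sub_algebraMap_ne_zero (α i)

theorem ord_nodalFun_inftyPlace : (inftyPlace F q).ord (nodalFun α) = -(q * m : ℕ) := by
  rw [ord_nodalFun, Finset.sum_congr rfl (g := fun _ => -(q : ℤ))]
  · simp [mul_comm]
  · intro i _
    rw [Place.ord, Place.val_sub_algebraMap_of_one_lt _ one_lt_val_fx_inftyPlace]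
    exact ord_fx_inftyPlace

variable {α β}

/-- The comparison is made for each `i` separately: either `P` is one of the `q` points above `α i`,
exactly once and with `x - α i` as uniformizer, or `x - α i` is a unit at `P` and no such point is
`P`. -/
theorem infoDivisor_eq_ord_nodalFun
    (hβ : ∀ i, Function.Injective (β i)) {P : Place F (FunField F q)}
    (hx : P.val (fx F q) ≤ 1) : infoDivisor α β hP P = P.ord (nodalFun α) := by
  classical
  have hinf : inftyPlace F q ≠ P := by
    rintro rfl
    exact hx.not_gt one_lt_val_fx_inftyPlace
  rw [infoDivisor_apply, if_neg hinf, sub_zero, ord_nodalFun]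
  refine Finset.sum_congr rfl fun i _ => ?_
  by_cases hi : P.val (fx F q - algebraMap F _ (α i)) < 1
  · obtain ⟨w, hw⟩ := exists_isOver (hβ i) (hP i) hi
    rw [Finset.sum_eq_single w, if_pos (hw.eq_affinePlace (hP i w)).symm, hw.ord_fx_sub (hP i w)]
    · intro z _ hz
      refine if_neg fun heq => hz (hβ i ?_)
      have h1 := (affinePlace_isOver _ _ (hP i z)).2
      rw [heq] at h1
      exact P.eq_of_val_sub_algebraMap_lt_one h1 hw.2
    · simp
  · have h1 : P.val (fx F q - algebraMap F _ (α i)) = 1 :=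
      le_antisymm (P.val_sub_algebraMap_le_one hx _) (not_lt.mp hi)
    rw [Place.ord, h1, WithZero.log_one, neg_zero]
    refine Finset.sum_eq_zero fun z _ => if_neg fun heq => hi ?_
    rw [← heq]
    exact (affinePlace_isOver _ _ (hP i z)).1

/-- The inequality at infinity is strict because of the term `-P_∞`: it excludes the pole order `q *
m` that the zero of `h` alone would allow. -/
theorem mem_RRSpace_infoDivisor_iff_forall
    (hβ : ∀ i, Function.Injective (β i)) (g : FunField F q) :
    hFun α * g ∈ RRSpace (infoDivisor α β hP) ↔
      (∀ P : Place F (FunField F q), P.val (fx F q) ≤ 1 → P.val g ≤ 1) ∧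
        (inftyPlace F q).val g < WithZero.exp ((q * m : ℕ) : ℤ) := by
  by_cases hg : g = 0
  · subst hg
    simp
  have hN := nodalFun_ne_zero (q := q) α
  have hh : hFun (q := q) α ≠ 0 := hFun_eq (q := q) α ▸ inv_ne_zero hN
  have hord : ∀ P : Place F (FunField F q),
      P.ord (hFun α * g) = -P.ord (nodalFun α) + P.ord g := fun P => by
    rw [P.ord_mul hh hg, hFun_eq, P.ord_inv]
  have h1 : hFun α * g ∈ RRSpace (infoDivisor α β hP) ↔
      ∀ P : Place F (FunField F q), 0 ≤ P.ord (hFun α * g) + infoDivisor α β hP P :=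
    or_iff_right (mul_ne_zero hh hg)
  have h2 : (inftyPlace F q).val g < WithZero.exp ((q * m : ℕ) : ℤ) ↔
      0 ≤ (inftyPlace F q).ord (hFun α * g) + infoDivisor α β hP (inftyPlace F q) := by
    rw [hord, ord_nodalFun_inftyPlace, infoDivisor_inftyPlace, Place.val_eq_exp _ hg,
      WithZero.exp_lt_exp]
    omega
  have h3 : ∀ P : Place F (FunField F q), P.val (fx F q) ≤ 1 →
      (P.val g ≤ 1 ↔ 0 ≤ P.ord (hFun α * g) + infoDivisor α β hP P) := fun P hx => by
    rw [hord, infoDivisor_eq_ord_nodalFun hP hβ hx, P.val_le_one_iff hg]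
    constructor <;> intro h <;> linarith
  rw [h1, h2]
  refine ⟨fun h => ⟨fun P hx => (h3 P hx).mpr (h P), h _⟩, fun h P => ?_⟩
  by_cases hx : P.val (fx F q) ≤ 1
  · exact (h3 P hx).mp (h.1 P hx)
  · rw [P.eq_inftyPlace (not_le.mp hx)]
    exact h.2

/-- Every nonzero prime of the coordinate ring yields a place at which `x` is regular, and a
Dedekind domain is the intersection of its valuation rings. -/
theorem exists_algebraMap_eq_of_forall_val_le_one {g : FunField F q}
    (hg : ∀ P : Place F (FunField F q), P.val (fx F q) ≤ 1 → P.val g ≤ 1) :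
    ∃ r : CoordRing F q, algebraMap _ _ r = g := by
  refine IsDedekindDomain.HeightOneSpectrum.mem_integers_of_valuation_le_one _ g fun v => ?_
  let P : Place F (FunField F q) :=
    { val := v.valuation (FunField F q)
      surjective := v.valuation_surjective (FunField F q)
      trivial_on := by
        intro c hc
        rw [IsScalarTower.algebraMap_apply F (CoordRing F q) (FunField F q),
          IsDedekindDomain.HeightOneSpectrum.valuation_eq_one_iff_notMem]
        intro hmem
        exact v.isPrime.ne_top
          (Ideal.eq_top_of_isUnit_mem _ hmem ((isUnit_iff_ne_zero.mpr hc).map (algebraMap F _))) }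
  exact hg P (v.valuation_le_one _)

theorem mem_RRSpace_infoDivisor_iff
    (hβ : ∀ i, Function.Injective (β i)) (f : FunField F q) :
    f ∈ RRSpace (infoDivisor α β hP) ↔ ∃ g : Fin q → F[X],
      (∀ z, (g z).degree < (m - z : ℕ)) ∧
        f = hFun α * ∑ z, aeval (fx F q) (g z) * fy F q ^ (z : ℕ) := by
  have hq := one_lt_q F q
  -- With `d = deg g`, the pole order is `q * (d + z) + z`, and `0 ≤ z < q` makes it less than `q *
  -- m` exactly when `d + z < m`. If `z ≥ m`, the truncated difference is `0` and both sides force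
  -- `g = 0`.
  have hdeg : ∀ (g : F[X]) (z : Fin q), g.degree < (m - z : ℕ) ↔
      (inftyPlace F q).val (aeval (fx F q) g * fy F q ^ (z : ℕ)) <
        WithZero.exp ((q * m : ℕ) : ℤ) := by
    intro g z
    by_cases hg : g = 0
    · simp [hg]
    · rw [val_inftyPlace_aeval_mul_pow hg, degree_eq_natDegree hg, WithZero.exp_lt_exp,
        Nat.cast_lt, Nat.cast_lt]
      have hz := z.2
      have e : q * g.natDegree + (q + 1) * z = z + q * (g.natDegree + z) := by ring
      rw [e, lt_tsub_iff_right]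
      constructor
      · intro h
        calc (z : ℕ) + q * (g.natDegree + z) < q + q * (g.natDegree + z) := by omega
          _ = q * (g.natDegree + z + 1) := by ring
          _ ≤ q * m := Nat.mul_le_mul_left q h
      · intro h
        exact lt_of_mul_lt_mul_left (lt_of_le_of_lt (Nat.le_add_left _ _) h) (Nat.zero_le q)
  constructor
  · intro hf
    have hN : hFun (q := q) α ≠ 0 := hFun_eq (q := q) α ▸ inv_ne_zero (nodalFun_ne_zero α)
    have hf' : hFun α * ((hFun α)⁻¹ * f) = f := mul_inv_cancel_left₀ hN f
    rw [← hf', mem_RRSpace_infoDivisor_iff_forall hP hβ] at hf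
    obtain ⟨r, hr⟩ := exists_algebraMap_eq_of_forall_val_le_one hf.1
    obtain ⟨g, hg⟩ := algebraMap_coordRing_eq_sum F q r
    rw [hr] at hg
    refine ⟨g, fun z => (hdeg _ z).mpr ((val_inftyPlace_le_val_sum g z).trans_lt ?_), ?_⟩
    · rw [← hg]
      exact hf.2
    · rw [← hg, hf']
  · rintro ⟨g, hg, rfl⟩
    rw [mem_RRSpace_infoDivisor_iff_forall hP hβ]
    refine ⟨fun P hx => P.val.map_sum_le fun z _ => ?_,
      Valuation.map_sum_lt _ WithZero.exp_ne_zero fun z _ => (hdeg _ z).mp (hg z)⟩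
    rw [map_mul, map_pow]
    exact mul_le_one' (P.val_aeval_le_one hx _) (pow_le_one' (P.val_fy_le_one hx) _)

end InfoDivisor

/-! ### Lagrange interpolation for each power of `y` -/

section Basis

variable {F : Type*} [Field F] {q m : ℕ}

/-- The polynomial `∏ i' ≠ i, (X - α i')`, the product over the indices `i'` with `i' + z < m`. -/
def nodalPoly (α : Fin m → F) (p : Index q m) : F[X] :=
  ∏ i' ∈ Finset.univ.filter (fun i' : Fin m => (i' : ℕ) + (p.1.2 : ℕ) < m ∧ i' ≠ p.1.1),
    (X - C (α i'))

theorem hBar_eq [Fintype F] [Fact (Fintype.card F = q ^ 2)] (α : Fin m → F) (p : Index q m) :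
    hBar α p = aeval (fx F q) (nodalPoly α p) * fy F q ^ (p.1.2 : ℕ) := by
  simp [hBar, nodalPoly, map_prod, mul_comm]

theorem card_filter_add_lt (z : ℕ) :
    (Finset.univ.filter fun i : Fin m => (i : ℕ) + z < m).card = m - z := by
  have : ∀ i : Fin m, (i : ℕ) + z < m ↔ (i : ℕ) < m - z := fun i => by omega
  simp only [this]
  rw [Fin.card_filter_val_lt]
  omega

theorem degree_nodalPoly (α : Fin m → F) (p : Index q m) :
    (nodalPoly α p).degree < (m - p.1.2 : ℕ) := by
  rw [nodalPoly, degree_prod, Finset.sum_congr rfl fun i _ => degree_X_sub_C (α i),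
    Finset.sum_const, nsmul_one, Nat.cast_lt, ← card_filter_add_lt]
  -- The index of `p` itself is among the `m - z` admissible ones but is left out of the product, so
  -- the degree is strictly smaller.
  refine Finset.card_lt_card (Finset.ssubset_iff.mpr ⟨p.1.1, by simp, fun i hi => ?_⟩)
  rw [Finset.mem_insert, Finset.mem_filter] at hi
  rcases hi with rfl | hi
  · simpa using p.2
  · simpa using hi.2.1

theorem eval_nodalPoly_ne_zero {α : Fin m → F} (hα : Function.Injective α) (p : Index q m) :
    (nodalPoly α p).eval (α p.1.1) ≠ 0 := by
  rw [nodalPoly, eval_prod, Finset.prod_ne_zero_iff]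
  intro i hi
  rw [eval_sub, eval_X, eval_C, sub_ne_zero]
  exact hα.ne (Finset.mem_filter.mp hi).2.2.symm

theorem eval_nodalPoly_eq_zero (α : Fin m → F) {p p' : Index q m} (hz : p.1.2 = p'.1.2)
    (hne : p ≠ p') : (nodalPoly α p).eval (α p'.1.1) = 0 := by
  rw [nodalPoly, eval_prod]
  refine Finset.prod_eq_zero (i := p'.1.1) (Finset.mem_filter.mpr ⟨Finset.mem_univ _, ?_, ?_⟩)
    (by simp)
  · rw [hz]
    exact p'.2
  · exact fun h => hne (Subtype.ext (Prod.ext h.symm hz))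

/-- The polynomial coefficient of `y ^ z` in `∑ p, c p * h̄ p`. -/
def rowPoly (α : Fin m → F) (c : Index q m → F) (z : Fin q) : F[X] :=
  ∑ p : Index q m, if p.1.2 = z then C (c p) * nodalPoly α p else 0

theorem sum_smul_hBar [Fintype F] [Fact (Fintype.card F = q ^ 2)] (α : Fin m → F)
    (c : Index q m → F) : ∑ p, c p • hBar α p =
      ∑ z, aeval (fx F q) (rowPoly α c z) * fy F q ^ (z : ℕ) := by
  simp only [rowPoly, map_sum, Finset.sum_mul]
  rw [Finset.sum_comm]
  refine Finset.sum_congr rfl fun p _ => ?_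
  rw [Finset.sum_eq_single p.1.2 (fun z _ hz => by simp [hz.symm]) (by simp), if_pos rfl, hBar_eq,
    Algebra.smul_def, map_mul, aeval_C, mul_assoc]

theorem degree_rowPoly (α : Fin m → F) (c : Index q m → F) (z : Fin q) :
    (rowPoly α c z).degree < (m - z : ℕ) := by
  rw [rowPoly, ← mem_degreeLT]
  refine Submodule.sum_mem _ fun p _ => ?_
  split_ifs with hz
  · rw [← smul_eq_C_mul, ← hz]
    exact Submodule.smul_mem _ _ (mem_degreeLT.mpr (degree_nodalPoly α p))
  · exact zero_mem _

/-- At the node of `p` every other polynomial in the same row vanishes, so evaluation isolates the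
coefficient `c p`. -/
theorem eval_rowPoly (α : Fin m → F) (c : Index q m → F) (p : Index q m) :
    (rowPoly α c p.1.2).eval (α p.1.1) = c p * (nodalPoly α p).eval (α p.1.1) := by
  rw [rowPoly, eval_finsetSum, Finset.sum_eq_single p]
  · simp
  · intro p' _ hne
    split_ifs with hz
    · rw [eval_mul, eval_nodalPoly_eq_zero α hz hne, mul_zero]
    · exact eval_zero
  · simp

theorem exists_rowPoly_eq {α : Fin m → F} (hα : Function.Injective α) {g : Fin q → F[X]}
    (hg : ∀ z, (g z).degree < (m - z : ℕ)) : ∃ c : Index q m → F, rowPoly α c = g := by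
  -- Lagrange coefficients: both sides have degree below `m - z` and agree at the `m - z` nodes of
  -- row `z`.
  refine ⟨fun p => (g p.1.2).eval (α p.1.1) / (nodalPoly α p).eval (α p.1.1), ?_⟩
  funext z
  refine eq_of_degrees_lt_of_eval_index_eq
    (Finset.univ.filter fun i : Fin m => (i : ℕ) + (z : ℕ) < m) (v := α) hα.injOn ?_ ?_ ?_
  · rw [card_filter_add_lt]
    exact degree_rowPoly α _ z
  · rw [card_filter_add_lt]
    exact hg z
  · intro i hi
    let p : Index q m := ⟨(i, z), (Finset.mem_filter.mp hi).2⟩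
    refine (eval_rowPoly α _ p).trans ?_
    rw [div_mul_cancel₀ _ (eval_nodalPoly_ne_zero hα p)]

end Basis

end Hermitian

end

/-! ### Assembly of the basis -/

theorem mainTheorem3 (q m : ℕ) (hq : IsPrimePow q)
    (F : Type*) [Field F] [Fintype F] [Fact (Fintype.card F = q ^ 2)]
    (hm : q - 1 ≤ m) (hm' : m ≤ q ^ 2 - 1)
    (α : Fin m → F) (hα : Function.Injective α) (hα0 : ∀ i, α i ≠ 0)
    (β : Fin m → Fin q → F) (hβ : ∀ i, Function.Injective (β i))
    (hP : ∀ i z, β i z ^ q + β i z = α i ^ (q + 1)) :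
    ∃ b : Module.Basis (Hermitian.Index q m) F
        (Hermitian.RRSpace (Hermitian.infoDivisor α β hP)),
      ∀ p, (b p : Hermitian.FunField F q) = Hermitian.hFun α * Hermitian.hBar α p := by
  have hh : Hermitian.hFun (q := q) α ≠ 0 :=
    Hermitian.hFun_eq (q := q) α ▸ inv_ne_zero (Hermitian.nodalFun_ne_zero α)
  have hmem := Hermitian.mem_RRSpace_infoDivisor_iff hP hβ
  have hsum (c : Hermitian.Index q m → F) :
      ∑ p, c p • (Hermitian.hFun α * Hermitian.hBar α p) =
        Hermitian.hFun α * ∑ z, aeval (Hermitian.fx F q) (Hermitian.rowPoly α c z) *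
          Hermitian.fy F q ^ (z : ℕ) := by
    rw [← Hermitian.sum_smul_hBar, Finset.mul_sum]
    exact Finset.sum_congr rfl fun p _ => (mul_smul_comm _ _ _).symm
  have hli : LinearIndependent F fun p : Hermitian.Index q m =>
      Hermitian.hFun α * Hermitian.hBar α p := by
    rw [Fintype.linearIndependent_iff]
    intro c hc p
    rw [hsum] at hc
    -- A vanishing combination has all row polynomials zero, by the independence of the powers `y ^
    -- z` over the polynomials in `x`; evaluation at a node then gives `c p = 0`.
    have h0 := Hermitian.eq_zero_of_sum_eq_zero ((mul_eq_zero.mp hc).resolve_left hh)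
    have h1 := Hermitian.eval_rowPoly α c p
    rw [h0, Pi.zero_apply, eval_zero] at h1
    exact (mul_eq_zero.mp h1.symm).resolve_right (Hermitian.eval_nodalPoly_ne_zero hα p)
  have hspan : Submodule.span F (Set.range fun p : Hermitian.Index q m =>
      Hermitian.hFun α * Hermitian.hBar α p) =
        Hermitian.RRSpace (Hermitian.infoDivisor α β hP) := by
    ext f
    rw [Submodule.mem_span_range_iff_exists_fun, hmem]
    constructor
    · rintro ⟨c, rfl⟩
      exact ⟨Hermitian.rowPoly α c, Hermitian.degree_rowPoly α c, hsum c⟩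
    · rintro ⟨g, hg, rfl⟩
      obtain ⟨c, rfl⟩ := Hermitian.exists_rowPoly_eq hα hg
      exact ⟨c, hsum c⟩
  refine ⟨(Module.Basis.span hli).map (LinearEquiv.ofEq _ _ hspan), fun p => ?_⟩
  rw [Module.Basis.map_apply, LinearEquiv.coe_ofEq_apply, Module.Basis.span_apply]
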